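/- For an integer $k\ge 1$ and a point $p$ of the Euclidean plane, let $\ell_i(p)$ ($0\le i<k$) be the ray from $p$ in direction $2\pi i/k$, and let the sector $s_i(p)$ be the set of points $p+r(\cos\theta,\sin\theta)$ with $r>0$ and $2\pi i/k\le\theta<2\pi(i+1)/k$. A finite point set $P$ is in general position (with respect to $k$) if no point of $P$ lies on a ray $\ell_i(p)$ of another point $p\in P$, and no two distinct points of $P$ lying in the same sector of a point $p\in P$ are at the same distance from $p$. Given an order $p_1,\dots,p_n$ of the points of such a set, its $k$-sector ordered Yao graph is the directed graph on these points in which, for each $p_j$ and each of the $k$ sectors of $p_j$ that contains at least one of $p_1,\dots,p_{j-1}$, there is an edge from $p_j$ to the closest of these predecessors in that sector. Let $e_k(n)$ be the maximum integer $m$ with the following property: there exists an $n$-point set in general position in the plane such that for every order of it the corresponding $k$-sector ordered Yao graph has at least $m$ edges. **Theorem.** For each fixed $k\ge 2$, $$e_k(n)=n\left\lceil \tfrac k2\right\rceil-o(n)\qquad\text{as } n\to\infty .$$ Moreover, there are absolute constants $C,c>0$ such that for all integers $k\ge 4$ and $n\ge 0$, $$n\left\lceil \tfrac k2\right\rceil-C\,k^3\sqrt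 n\;\le\; e_k(n)\;\le\; n\left\lceil \tfrac k2\right\rceil-c\,k\sqrt n .$$ -/

import Mathlib

open Filter Asymptotics

noncomputable section

namespace OrderedYao

/-- The Euclidean plane. -/
abbrev Plane : Type := EuclideanSpace ℝ (Fin 2)

/-- The sector `s_i(p)`, `0 ≤ i < k`: the points `p + r (cos θ, sin θ)` with `r > 0` and
`2πi/k ≤ θ < 2π(i+1)/k`. It contains its first boundary ray and not its apex `p`. -/
def sector (k : ℕ) (i : Fin k) (p : Plane) : Set Plane :=
  {q | ∃ r θ : ℝ, 0 < r ∧ 2 * Real.pi * (i : ℝ) / k ≤ θ ∧ θ < 2 * Real.pi * ((i : ℝ) + 1) / k ∧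
    q 0 = p 0 + r * Real.cos θ ∧ q 1 = p 1 + r * Real.sin θ}

/-- The (open) sector-bounding ray `ℓ_i(p)`, in direction `2πi/k`. -/
def boundaryRay (k : ℕ) (i : Fin k) (p : Plane) : Set Plane :=
  {q | ∃ r : ℝ, 0 < r ∧ q 0 = p 0 + r * Real.cos (2 * Real.pi * (i : ℝ) / k) ∧
    q 1 = p 1 + r * Real.sin (2 * Real.pi * (i : ℝ) / k)}

/-- General position with respect to `k` sectors: no point of `P` lies on a sector-bounding ray of
another one, and no two distinct points in the same sector of a third one are at the same distance
from it. -/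
def GeneralPosition (k : ℕ) (P : Set Plane) : Prop :=
  (∀ p ∈ P, ∀ q ∈ P, ∀ i : Fin k, q ∉ boundaryRay k i p) ∧
  (∀ p ∈ P, ∀ q ∈ P, ∀ r ∈ P, ∀ i : Fin k, q ∈ sector k i p → r ∈ sector k i p →
    dist p q = dist p r → q = r)

/-- The `k`-sector ordered Yao graph of the points `x 0, x 1, …, x (n - 1)` taken in this order;
the vertex `j` stands for the point `x j`. There is an edge from `j` to `i` when `x i` is the
closest predecessor of `x j` in one of the `k` sectors of `x j`. -/
def yaoGraph (k : ℕ) {n : ℕ} (x : Fin n → Plane) : Digraph (Fin n) where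
  Adj j i := i < j ∧ ∃ s : Fin k, x i ∈ sector k s (x j) ∧
    ∀ l : Fin n, l < j → x l ∈ sector k s (x j) → dist (x j) (x i) ≤ dist (x j) (x l)

/-- The number of edges of the `k`-sector ordered Yao graph. -/
def edgeCount (k : ℕ) {n : ℕ} (x : Fin n → Plane) : ℕ :=
  {e : Fin n × Fin n | (yaoGraph k x).Adj e.1 e.2}.ncard

/-- The sequence `x` is an order of the point set `P`: it lists each point exactly once. -/
def IsOrderOf {n : ℕ} (x : Fin n → Plane) (P : Set Plane) : Prop :=
  Function.Injective x ∧ Set.range x = P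

/-- The integers `m` such that for some `n`-point set in general position, the `k`-sector ordered
Yao graph of every order of it has at least `m` edges. -/
def unavoidable (k n : ℕ) : Set ℕ :=
  {m | ∃ P : Finset Plane, P.card = n ∧ GeneralPosition k (P : Set Plane) ∧
    ∀ x : Fin n → Plane, IsOrderOf x (P : Set Plane) → m ≤ edgeCount k x}

/-- `e_k(n)`, the maximum of `unavoidable k n` (a maximum exists by `isGreatest_e`). -/
def e (k n : ℕ) : ℕ := sSup (unavoidable k n)

/-- An example of points in general position: `2^j (cos (π/(2k)), sin (π/(2k)))`. -/
def linePt (k j : ℕ) : Plane :=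
  !₂[2 ^ j * Real.cos (Real.pi / (2 * k)), 2 ^ j * Real.sin (Real.pi / (2 * k))]

theorem dist_linePt (k a b : ℕ) : dist (linePt k a) (linePt k b) = |(2 : ℝ) ^ a - 2 ^ b| := by
  rw [EuclideanSpace.dist_eq, Fin.sum_univ_two, ← Real.sqrt_sq_eq_abs]
  congr 1
  simp only [linePt, Real.dist_eq, sq_abs]
  simp
  linear_combination ((2 : ℝ) ^ a - 2 ^ b) ^ 2 * Real.cos_sq_add_sin_sq (Real.pi / (2 * k))

theorem linePt_injective (k : ℕ) : Function.Injective (linePt k) := by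
  intro a b h
  have h1 := dist_linePt k a b
  rw [h, dist_self] at h1
  have h2 : (2 : ℝ) ^ a = 2 ^ b := sub_eq_zero.mp (abs_eq_zero.mp h1.symm)
  exact pow_right_injective₀ (by norm_num : (0 : ℝ) < 2) (by norm_num) h2

theorem linePt_not_mem_boundaryRay {k : ℕ} (hk : 1 ≤ k) (a b : ℕ) (i : Fin k) :
    linePt k b ∉ boundaryRay k i (linePt k a) := by
  rintro ⟨r, hr, h0, h1⟩
  simp [linePt] at h0 h1
  set α := Real.pi / (2 * k) with hα
  set β := 2 * Real.pi * (i : ℝ) / k with hβ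
  have hs : Real.sin (α - β) = 0 := by
    have : r * Real.sin (α - β) = 0 := by
      rw [Real.sin_sub]
      linear_combination Real.cos α * h1 - Real.sin α * h0
    exact (mul_eq_zero.mp this).resolve_left hr.ne'
  obtain ⟨m, hm⟩ := Real.sin_eq_zero_iff.mp hs
  have hk0 : (k : ℝ) ≠ 0 := by positivity
  have hpi := Real.pi_ne_zero
  have : (2 * k * m + 4 * (i : ℕ) : ℝ) = 1 := by
    rw [hα, hβ] at hm
    field_simp at hm
    linarith
  have h' : (2 * k * m + 4 * (i : ℕ) : ℤ) = 1 := by exact_mod_cast this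
  have : (2 : ℤ) ∣ 1 := ⟨k * m + 2 * (i : ℕ), by rw [← h']; ring⟩
  norm_num at this

theorem two_pow_add_ne {a b c : ℕ} (h : 2 ^ a + 2 ^ b = 2 * 2 ^ c) : a = b := by
  wlog hab : a ≤ b generalizing a b
  · exact (this (by rw [add_comm]; exact h) (by omega)).symm
  by_contra hne
  have h1 : 2 ^ (c + 1) < 2 ^ (b + 1) := by
    have : 2 ^ a < 2 ^ b := Nat.pow_lt_pow_right (by norm_num) (by omega)
    rw [pow_succ, pow_succ]; omega
  have h2 : c + 1 ≤ b := by
    have := (Nat.pow_lt_pow_iff_right (by norm_num : 1 < 2)).mp h1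
    omega
  have h3 : 2 ^ (c + 1) ≤ 2 ^ b := Nat.pow_le_pow_right (by norm_num) h2
  have h4 : 0 < 2 ^ a := by positivity
  rw [pow_succ] at h3
  omega

theorem generalPosition_linePt {k : ℕ} (hk : 1 ≤ k) :
    GeneralPosition k (Set.range (linePt k)) := by
  constructor
  · rintro _ ⟨a, rfl⟩ _ ⟨b, rfl⟩ i
    exact linePt_not_mem_boundaryRay hk a b i
  · rintro _ ⟨a, rfl⟩ _ ⟨b, rfl⟩ _ ⟨c, rfl⟩ i - - h
    rw [dist_linePt, dist_linePt] at h
    rcases abs_eq_abs.mp h with h | h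
    · have h2 : (2 : ℝ) ^ b = 2 ^ c := by linarith
      rw [pow_right_injective₀ (by norm_num : (0 : ℝ) < 2) (by norm_num) h2]
    · have h2 : (2 : ℝ) ^ b + 2 ^ c = 2 * 2 ^ a := by linarith
      rw [two_pow_add_ne (by exact_mod_cast h2 : 2 ^ b + 2 ^ c = 2 * 2 ^ a)]

/-- For `k ≥ 1` the number `e_k(n)` is well defined. -/
theorem isGreatest_e {k : ℕ} (hk : 1 ≤ k) (n : ℕ) : IsGreatest (unavoidable k n) (e k n) := by
  have hne : (unavoidable k n).Nonempty := by
    refine ⟨0, (Finset.range n).map ⟨linePt k, linePt_injective k⟩, by simp, ?_, by simp⟩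
    obtain ⟨h1, h2⟩ := generalPosition_linePt hk
    have hsub : ((((Finset.range n).map ⟨linePt k, linePt_injective k⟩ : Finset Plane)) :
        Set Plane) ⊆ Set.range (linePt k) := by
      intro p hp
      simp only [Finset.coe_map, Function.Embedding.coeFn_mk] at hp
      obtain ⟨j, -, rfl⟩ := hp
      exact ⟨j, rfl⟩
    exact ⟨fun p hp q hq => h1 p (hsub hp) q (hsub hq),
      fun p hp q hq r hr => h2 p (hsub hp) q (hsub hq) r (hsub hr)⟩
  have hbdd : BddAbove (unavoidable k n) := by
    refine ⟨n * n, ?_⟩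
    rintro m ⟨P, hP, -, h⟩
    let f := (Finset.equivFinOfCardEq hP).symm
    refine (h (fun j => (f j : Plane)) ⟨Subtype.val_injective.comp f.injective, ?_⟩).trans ?_
    · ext p
      constructor
      · rintro ⟨j, rfl⟩
        exact (f j).2
      · intro hp
        exact ⟨f.symm ⟨p, hp⟩, by simp⟩
    · have := Set.ncard_le_card {e : Fin n × Fin n |
        (yaoGraph k (fun j => (f j : Plane))).Adj e.1 e.2}
      simpa [edgeCount] using this
  exact ⟨Nat.sSup_mem hne hbdd, fun m hm => le_csSup hbdd hm⟩

end OrderedYao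

end

namespace OrderedYao

open Real Filter Topology

/-! In general position, edges correspond to occupied slots: pairs of a point and a sector of it
that contains a predecessor. Both bounds count slots.

Upper bound. Build an order from its end by deleting extreme points. A point that is extreme for a
line in a boundary direction sees the rest in an open half-plane, which meets at most `⌈k/2⌉`
sectors. To save more, use two boundary directions at angle `2πb/k`. By Erdős–Szekeres, some chain
`C` of at least `√n` points is ordered by the two heights in the same way or in opposite ways
(`exists_chain`). Extreme points outside `C` are deleted first, so each point of `C` is deleted when
extreme in both directions. It then sees only a wedge, which saves `b` sectors
(`achievable_of_chain`). Take `b = ⌊k/4⌋`.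

Lower bound. Take a slightly perturbed square block of lattice points and, as gadgets, translates of
a rounded regular `k`-gon. Vertex `j` sees vertex `σ j = j + ⌊k/2⌋` in its sector `j`, and is seen
from there in sector `σ j`. Whichever comes later has its slot occupied, so the unoccupied indices
`U` satisfy `U ∩ σ(U) = ∅` and at least `⌈k/2⌉` of the slots (vertex `j`, sector `j`) are occupied.
Different translates use different slots, and all but `O(k√n)` translates fit
(`mul_card_le_ncard_slots`, `exists_finset_translates`). -/

/-! ### Sectors in polar coordinates. -/

theorem cos_sin_sub_eq_zero {r r' θ θ' : ℝ} (h0 : r * cos θ = r' * cos θ')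
    (h1 : r * sin θ = r' * sin θ') : r * sin (θ - θ') = 0 := by
  rw [sin_sub]; linear_combination cos θ' * h1 - sin θ' * h0

theorem sector_angle_nonneg {k : ℕ} (i : Fin k) : 0 ≤ 2 * π * (i : ℝ) / k := by positivity

theorem sector_angle_le {k : ℕ} (i : Fin k) : 2 * π * ((i : ℝ) + 1) / k ≤ 2 * π := by
  have hk : (0 : ℝ) < k := by exact_mod_cast i.pos
  have : (i : ℝ) + 1 ≤ k := by exact_mod_cast i.2
  rw [div_le_iff₀ hk]
  gcongr

/-- The sectors of a point are pairwise disjoint. -/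
theorem eq_of_mem_sector {k : ℕ} {i j : Fin k} {p q : Plane} (hi : q ∈ sector k i p)
    (hj : q ∈ sector k j p) : i = j := by
  obtain ⟨r, θ, hr, hl, hu, h0, h1⟩ := hi
  obtain ⟨r', θ', hr', hl', hu', h0', h1'⟩ := hj
  have hk : (0 : ℝ) < k := by exact_mod_cast i.pos
  have e0 : r * cos θ = r' * cos θ' := by linarith
  have e1 : r * sin θ = r' * sin θ' := by linarith
  have hrr : r = r' := by
    have : r ^ 2 = r' ^ 2 := by
      have a := cos_sq_add_sin_sq θ
      have b := cos_sq_add_sin_sq θ'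
      linear_combination (r * cos θ + r' * cos θ') * e0 + (r * sin θ + r' * sin θ') * e1
        - r ^ 2 * a + r' ^ 2 * b
    exact (pow_left_inj₀ hr.le hr'.le two_ne_zero).mp this
  subst hrr
  have hc : cos (θ - θ') = 1 := by
    rw [cos_sub, ← mul_left_cancel₀ hr.ne' e0, ← mul_left_cancel₀ hr.ne' e1]
    nlinarith [cos_sq_add_sin_sq θ]
  have b1 := sector_angle_nonneg i
  have b2 := sector_angle_nonneg j
  have b3 := sector_angle_le i
  have b4 := sector_angle_le j
  have : θ - θ' = 0 :=
    (cos_eq_one_iff_of_lt_of_lt (by linarith) (by linarith)).mp hc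
  have hθ : θ = θ' := by linarith
  subst hθ
  have key : ∀ a b : Fin k, 2 * π * (a : ℝ) / k ≤ θ → θ < 2 * π * ((b : ℝ) + 1) / k → a ≤ b := by
    intro a b h1 h2
    have := h1.trans_lt h2
    rw [div_lt_div_iff_of_pos_right hk, mul_lt_mul_iff_right₀ (by positivity)] at this
    have : (a : ℕ) < b + 1 := by exact_mod_cast this
    exact Fin.le_def.mpr (by omega)
  exact le_antisymm (key i j hl hu') (key j i hl' hu)

/-- A sector contains no two vectors that are opposite as seen from the apex. -/
theorem neg_not_mem_sector {k : ℕ} (hk : 2 ≤ k) {i : Fin k} {p q q' : Plane}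
    (hq : q ∈ sector k i p) (hq' : q' ∈ sector k i p) (h0 : q 0 - p 0 = -(q' 0 - p 0))
    (h1 : q 1 - p 1 = -(q' 1 - p 1)) : False := by
  obtain ⟨r, θ, hr, hl, hu, e0, e1⟩ := hq
  obtain ⟨r', θ', hr', hl', hu', e0', e1'⟩ := hq'
  have hk0 : (0 : ℝ) < k := by positivity
  have f0 : r * cos θ = -r' * cos θ' := by linarith
  have f1 : r * sin θ = -r' * sin θ' := by linarith
  -- A half-open sector of width at most `π` forces `|θ - θ'| < π`; this is where `k ≥ 2` matters.
  have hw : 2 * π * ((i : ℝ) + 1) / k ≤ 2 * π * (i : ℝ) / k + π := by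
    have hk2 : (2 : ℝ) ≤ k := by exact_mod_cast hk
    rw [div_add' _ _ _ hk0.ne', div_le_div_iff_of_pos_right hk0]
    nlinarith [pi_pos]
  have hs := (mul_eq_zero.mp (cos_sin_sub_eq_zero f0 f1)).resolve_left hr.ne'
  have : θ - θ' = 0 := (sin_eq_zero_iff_of_lt_of_lt (by linarith) (by linarith)).mp hs
  have hθ : θ = θ' := by linarith
  subst hθ
  have hz : (r + r') ^ 2 = 0 := by
    have a := cos_sq_add_sin_sq θ
    linear_combination (r + r') * (cos θ * f0 + sin θ * f1) - (r + r') ^ 2 * a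
  nlinarith [pow_eq_zero_iff (two_ne_zero) |>.mp hz]

/-! ### Edges as occupied slots. -/

/-- The pairs of an index and a sector that contains a predecessor. -/
def slots (k : ℕ) {n : ℕ} (x : Fin n → Plane) : Set (Fin n × Fin k) :=
  {a | ∃ l < a.1, x l ∈ sector k a.2 (x a.1)}

/-- Each slot yields the edge to a closest predecessor; disjointness of sectors recovers the slot
from the edge. -/
theorem ncard_slots_le_edgeCount (k : ℕ) {n : ℕ} (x : Fin n → Plane) :
    (slots k x).ncard ≤ edgeCount k x := by
  have hex : ∀ a, ∃ i, a ∈ slots k x → i < a.1 ∧ x i ∈ sector k a.2 (x a.1) ∧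
      ∀ l < a.1, x l ∈ sector k a.2 (x a.1) → dist (x a.1) (x i) ≤ dist (x a.1) (x l) := by
    rintro ⟨j, s⟩
    by_cases ha : (j, s) ∈ slots k x
    swap
    · exact ⟨j, fun h => absurd h ha⟩
    obtain ⟨l, hl⟩ := ha
    obtain ⟨i, hi, hmin⟩ := Set.exists_min_image {l | l < j ∧ x l ∈ sector k s (x j)}
      (fun l => dist (x j) (x l)) (Set.toFinite _) ⟨l, hl⟩
    exact ⟨i, fun _ => ⟨hi.1, hi.2, fun l h1 h2 => hmin l ⟨h1, h2⟩⟩⟩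
  choose f hf using hex
  refine Set.ncard_le_ncard_of_injOn (fun a => (a.1, f a)) ?_ ?_ (Set.toFinite _)
  · intro a ha
    exact ⟨(hf a ha).1, a.2, (hf a ha).2⟩
  · rintro ⟨j, s⟩ ha ⟨j', s'⟩ hb h
    obtain ⟨rfl, h2⟩ := Prod.mk.injEq _ _ _ _ ▸ h
    have h1 := (hf _ ha).2.1
    have h3 := (hf _ hb).2.1
    rw [← h2] at h3
    exact Prod.ext rfl (eq_of_mem_sector h1 h3)

/-- Without distance ties a slot has only one closest predecessor, so it carries only one edge. -/
theorem edgeCount_le_ncard_slots {k n : ℕ} {x : Fin n → Plane} (hx : Function.Injective x)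
    (hgp : GeneralPosition k (Set.range x)) : edgeCount k x ≤ (slots k x).ncard := by
  have hex : ∀ a ∈ {a : Fin n × Fin n | (yaoGraph k x).Adj a.1 a.2}, ∃ s : Fin k,
      x a.2 ∈ sector k s (x a.1) ∧
      ∀ l < a.1, x l ∈ sector k s (x a.1) → dist (x a.1) (x a.2) ≤ dist (x a.1) (x l) :=
    fun a ha => ha.2
  by_cases hk : k = 0
  · subst hk
    have : {a : Fin n × Fin n | (yaoGraph 0 x).Adj a.1 a.2} = ∅ := by
      ext a
      simp only [Set.mem_ofPred_eq, Set.mem_empty_iff_false, iff_false]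
      rintro ⟨-, s, -⟩
      exact s.elim0
    simp [edgeCount, this]
  have : Nonempty (Fin k) := ⟨⟨0, by omega⟩⟩
  choose! f hmem hmin using hex
  refine Set.ncard_le_ncard_of_injOn (fun a => (a.1, f a)) ?_ ?_ (Set.toFinite _)
  · intro a ha
    exact ⟨a.2, ha.1, hmem a ha⟩
  · rintro ⟨j, i⟩ ha ⟨j', i'⟩ hb h
    obtain ⟨rfl, h2⟩ := Prod.mk.injEq _ _ _ _ ▸ h
    have h1 := hmem _ ha
    have h3 := hmem _ hb
    have d1 := hmin _ ha i' hb.1 (h2 ▸ h3)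
    have d2 := hmin _ hb i ha.1 (h2 ▸ h1)
    have := hgp.2 _ ⟨j, rfl⟩ _ ⟨i, rfl⟩ _ ⟨i', rfl⟩ _ h1 (h2 ▸ h3) (le_antisymm d1 d2)
    rw [hx this]

/-! ### Orders built by deleting points. -/

/-- The sectors of `p` that meet `S`. -/
def seen (k : ℕ) (S : Set Plane) (p : Plane) : Set (Fin k) := {s | ∃ q ∈ S, q ∈ sector k s p}

/-- Some order of `P` has at most `c` occupied slots. -/
def Achievable (k : ℕ) (P : Finset Plane) (c : ℕ) : Prop :=
  ∃ n : ℕ, ∃ x : Fin n → Plane, IsOrderOf x (P : Set Plane) ∧ (slots k x).ncard ≤ c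

theorem Achievable.empty (k : ℕ) : Achievable k ∅ 0 := by
  refine ⟨0, Fin.elim0, ⟨fun a => a.elim0, by simp⟩, ?_⟩
  rw [Set.eq_empty_of_isEmpty (slots k _)]
  simp

-- Placing `p` last leaves the slots of the other points unchanged and makes all of them
-- predecessors of `p`.
open Classical in
theorem Achievable.of_erase {k : ℕ} {P : Finset Plane} {p : Plane} (hp : p ∈ P) {c d : ℕ}
    (h : Achievable k (P.erase p) c) (hd : (seen k (P.erase p : Finset Plane) p).ncard ≤ d) :
    Achievable k P (c + d) := by
  obtain ⟨n, x, ⟨hinj, hran⟩, hc⟩ := h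
  refine ⟨n + 1, Fin.snoc (α := fun _ => Plane) x p, ⟨?_, ?_⟩, ?_⟩
  · rw [Fin.snoc_injective_iff]
    exact ⟨hinj, by rw [hran]; simp⟩
  · rw [Fin.range_snoc, hran]
    simp [hp]
  · have hsub : slots k (Fin.snoc (α := fun _ => Plane) x p) ⊆
        (fun a : Fin n × Fin k => (a.1.castSucc, a.2)) '' slots k x ∪
        (fun s => (Fin.last n, s)) '' seen k (P.erase p : Finset Plane) p := by
      rintro ⟨j, s⟩ ⟨l, hl, hm⟩
      dsimp only at hl hm
      have hln : l ≠ Fin.last n := (hl.trans_le (Fin.le_last j)).ne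
      obtain ⟨l, rfl⟩ := Fin.exists_castSucc_eq.mpr hln
      rw [Fin.snoc_castSucc] at hm
      rcases Fin.eq_castSucc_or_eq_last j with ⟨j, rfl⟩ | rfl
      · rw [Fin.snoc_castSucc] at hm
        exact Or.inl ⟨(j, s), ⟨l, Fin.castSucc_lt_castSucc_iff.mp hl, hm⟩, rfl⟩
      · rw [Fin.snoc_last] at hm
        exact Or.inr ⟨s, ⟨x l, by rw [← hran]; exact ⟨l, rfl⟩, hm⟩, rfl⟩
    refine (Set.ncard_le_ncard hsub (Set.toFinite _)).trans ((Set.ncard_union_le _ _).trans ?_)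
    exact add_le_add ((Set.ncard_image_le (Set.toFinite _)).trans hc)
      ((Set.ncard_image_le (Set.toFinite _)).trans hd)

open Classical in
/-- Removing the maximum of `f` or of `g` at each step so that the points of a chain `C` are the
maximum of both when they are removed. -/
theorem achievable_of_chain {k D b : ℕ} {f g : Plane → ℝ} (P : Finset Plane)
    (hf : ∀ S : Finset Plane, S ⊆ P → ∀ p ∈ P, (∀ q ∈ S, f q < f p) → (seen k S p).ncard ≤ D)
    (hg : ∀ S : Finset Plane, S ⊆ P → ∀ p ∈ P, (∀ q ∈ S, g q < g p) → (seen k S p).ncard ≤ D)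
    (hfg : ∀ S : Finset Plane, S ⊆ P → ∀ p ∈ P, (∀ q ∈ S, f q < f p ∧ g q < g p) →
      (seen k S p).ncard + b ≤ D)
    (hfi : Set.InjOn f P) (hgi : Set.InjOn g P) (C : Finset Plane) (hC : C ⊆ P)
    (hch : ∀ p ∈ C, ∀ q ∈ C, f p < f q → g p < g q) :
    ∃ c, Achievable k P c ∧ c + b * C.card ≤ D * P.card := by
  induction hn : P.card generalizing P C with
  | zero =>
    obtain rfl := Finset.card_eq_zero.mp hn
    obtain rfl := Finset.subset_empty.mp hC
    exact ⟨0, Achievable.empty k, by simp⟩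
  | succ n ih =>
    have step : ∀ p ∈ P, ∀ C' ⊆ C, p ∉ C' → ∀ d, (seen k (P.erase p : Finset Plane) p).ncard ≤ d →
        ∃ c, Achievable k P c ∧ c + b * C'.card ≤ D * n + d := by
      intro p hp C' hC' hpC' d hd
      have hs : P.erase p ⊆ P := Finset.erase_subset _ _
      obtain ⟨c, h1, h2⟩ := ih (P.erase p) (fun S hS q hq => hf S (hS.trans hs) q (hs hq))
        (fun S hS q hq => hg S (hS.trans hs) q (hs hq))
        (fun S hS q hq => hfg S (hS.trans hs) q (hs hq))
        (hfi.mono hs) (hgi.mono hs) C' (Finset.subset_erase.mpr ⟨hC'.trans hC, hpC'⟩)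
        (fun p hp q hq => hch p (hC' hp) q (hC' hq)) (by rw [Finset.card_erase_of_mem hp]; omega)
      exact ⟨c + d, h1.of_erase hp hd, by omega⟩
    have hne : P.Nonempty := Finset.card_pos.mp (by omega)
    have below : ∀ h : Plane → ℝ, Set.InjOn h P → ∀ p ∈ P, (∀ q ∈ P, h q ≤ h p) →
        ∀ q ∈ P.erase p, h q < h p := by
      intro h hi p hp hmax q hq
      obtain ⟨h1, h2⟩ := Finset.mem_erase.mp hq
      exact lt_of_le_of_ne (hmax q h2) fun he => h1 (hi h2 hp he)
    obtain ⟨p, hp, hpm⟩ := P.exists_max_image f hne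
    obtain ⟨q, hq, hqm⟩ := P.exists_max_image g hne
    by_cases hpC : p ∈ C
    · by_cases hqC : q ∈ C
      · have hpq : p = q := by
          by_contra hpq
          have h1 := below f hfi p hp hpm q (Finset.mem_erase.mpr ⟨Ne.symm hpq, hq⟩)
          exact absurd (hch q hqC p hpC h1) (not_lt.mpr (hqm p hp))
        subst hpq
        have hb := hfg (P.erase p) (Finset.erase_subset _ _) p hp fun r hr =>
          ⟨below f hfi p hp hpm r hr, below g hgi p hp hqm r hr⟩
        obtain ⟨c, h1, h2⟩ := step p hp (C.erase p) (Finset.erase_subset _ _)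
          (Finset.notMem_erase _ _) _ le_rfl
        refine ⟨c, h1, ?_⟩
        rw [← Finset.card_erase_add_one hpC]
        linarith
      · obtain ⟨c, h1, h2⟩ := step q hq C subset_rfl hqC D
          (hg _ (Finset.erase_subset _ _) q hq (below g hgi q hq hqm))
        exact ⟨c, h1, by linarith⟩
    · obtain ⟨c, h1, h2⟩ := step p hp C subset_rfl hpC D
        (hf _ (Finset.erase_subset _ _) p hp (below f hfi p hp hpm))
      exact ⟨c, h1, by linarith⟩

/-! ### Monotone subsequences. -/

open Classical in
/-- The Erdős–Szekeres theorem. -/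
theorem exists_chain {α : Type*} (P : Finset α) (f g : α → ℝ) (hg : Set.InjOn g P) :
    ∃ C ⊆ P, P.card ≤ C.card ^ 2 ∧ ((∀ p ∈ C, ∀ q ∈ C, f p < f q → g p < g q) ∨
      (∀ p ∈ C, ∀ q ∈ C, f p < f q → g q < g p)) := by
  let chains : α → Finset (Finset α) := fun p => P.powerset.filter fun C =>
    p ∈ C ∧ (∀ q ∈ C, q ≠ p → f q < f p ∧ g q < g p) ∧ ∀ a ∈ C, ∀ b ∈ C, f a < f b → g a < g b
  have hself : ∀ p ∈ P, {p} ∈ chains p := by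
    intro p hp
    simp [chains, hp]
  -- The length of a longest increasing chain ending at `p`. It strictly grows along increasing
  -- pairs, so its level sets are decreasing.
  let h : α → ℕ := fun p => (chains p).sup Finset.card
  have hatt : ∀ p ∈ P, ∃ C ∈ chains p, C.card = h p := by
    intro p hp
    obtain ⟨C, hC, he⟩ := Finset.exists_mem_eq_sup (chains p) ⟨_, hself p hp⟩ Finset.card
    exact ⟨C, hC, he.symm⟩
  have hmono : ∀ p ∈ P, ∀ q ∈ P, f p < f q → g p < g q → h p < h q := by
    intro p hp q hq hf hg
    obtain ⟨C, hC, hc⟩ := hatt p hp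
    simp only [chains, Finset.mem_filter, Finset.mem_powerset] at hC
    obtain ⟨hCP, hpC, htop, hch⟩ := hC
    have hlt : ∀ a ∈ C, f a < f q ∧ g a < g q := by
      intro a ha
      by_cases hap : a = p
      · subst hap; exact ⟨hf, hg⟩
      · have := htop a ha hap
        exact ⟨this.1.trans hf, this.2.trans hg⟩
    have hqC : q ∉ C := fun hqC => lt_irrefl _ (hlt q hqC).1
    have hmem : insert q C ∈ chains q := by
      simp only [chains, Finset.mem_filter, Finset.mem_powerset]
      refine ⟨Finset.insert_subset hq hCP, Finset.mem_insert_self _ _, ?_, ?_⟩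
      · intro a ha hne
        exact hlt a ((Finset.mem_insert.mp ha).resolve_left hne)
      · intro a ha b hb hab
        rcases Finset.mem_insert.mp ha with haq | ha <;>
          rcases Finset.mem_insert.mp hb with hbq | hb
        · exact absurd hab (by rw [haq, hbq]; exact lt_irrefl _)
        · exact absurd hab (by rw [haq]; exact (hlt b hb).1.not_gt)
        · rw [hbq]; exact (hlt a ha).2
        · exact hch a ha b hb hab
    have := Finset.le_sup (f := Finset.card) hmem
    rw [Finset.card_insert_of_notMem hqC] at this
    change _ ≤ h q at this
    omega
  rcases P.eq_empty_or_nonempty with rfl | hne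
  · exact ⟨∅, by simp⟩
  obtain ⟨p, hp, hpm⟩ := P.exists_max_image h hne
  by_cases hbig : P.card ≤ h p ^ 2
  · obtain ⟨C, hC, hc⟩ := hatt p hp
    simp only [chains, Finset.mem_filter, Finset.mem_powerset] at hC
    exact ⟨C, hC.1, hc ▸ hbig, Or.inl hC.2.2.2⟩
  · have hmaps : ∀ q ∈ P, h q ∈ Finset.Icc 1 (h p) := by
      intro q hq
      refine Finset.mem_Icc.mpr ⟨?_, hpm q hq⟩
      exact (Finset.card_singleton q).ge.trans (Finset.le_sup (f := Finset.card) (hself q hq))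
    have hpos := (Finset.mem_Icc.mp (hmaps p hp)).1
    have hcard := hne.card_pos
    push Not at hbig
    have hmul := Nat.mul_div_le (P.card - 1) (h p)
    -- Pigeonhole over at most `h p` levels: some level set has at least `P.card / h p` points.
    obtain ⟨y, -, hy⟩ := Finset.exists_lt_card_fiber_of_mul_lt_card_of_maps_to
      (n := (P.card - 1) / h p) hmaps (by rw [Nat.card_Icc, Nat.add_sub_cancel]; omega)
    refine ⟨P.filter fun q => h q = y, Finset.filter_subset _ _, ?_, Or.inr ?_⟩
    · set t := (P.filter fun q => h q = y).card
      have h1 := (Nat.div_lt_iff_lt_mul hpos).mp hy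
      have h2 : P.card ≤ t * h p := by omega
      by_contra! hlt
      nlinarith [Nat.mul_le_mul h2 h2, Nat.mul_lt_mul_of_lt_of_lt hlt hbig]
    · intro a ha b hb hab
      obtain ⟨ha, hay⟩ := Finset.mem_filter.mp ha
      obtain ⟨hb, hby⟩ := Finset.mem_filter.mp hb
      rcases lt_trichotomy (g a) (g b) with h1 | h1 | h1
      · exact absurd (hmono a ha b hb hab h1) (by omega)
      · rw [hg ha hb h1] at hab
        exact absurd hab (lt_irrefl _)
      · exact h1

/-! ### Half-planes in boundary directions and the upper bound. -/

/-- A linear functional whose kernel is spanned by the boundary direction `2πa/k`. -/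
noncomputable def height (k a : ℕ) (q : Plane) : ℝ :=
  cos (2 * π * a / k) * q 1 - sin (2 * π * a / k) * q 0

theorem height_sub_height {k a : ℕ} {p q : Plane} {r θ : ℝ} (h0 : q 0 = p 0 + r * cos θ)
    (h1 : q 1 = p 1 + r * sin θ) :
    height k a q - height k a p = r * sin (θ - 2 * π * a / k) := by
  rw [height, height, h0, h1, sin_sub]; ring

theorem exists_polar_eq {x y β : ℝ} (h : cos β * y - sin β * x = 0) :
    x = (x * cos β + y * sin β) * cos β ∧ y = (x * cos β + y * sin β) * sin β := by
  have a := cos_sq_add_sin_sq β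
  constructor
  · linear_combination -x * a - sin β * h
  · linear_combination -y * a + cos β * h

/-- Two points of equal height span a line in direction `2πa/k`, so one lies on a boundary ray of
the other. -/
theorem injOn_height {k a : ℕ} (ha : a < k) {P : Set Plane} (hP : GeneralPosition k P) :
    Set.InjOn (height k a) P := by
  intro p hp q hq h
  have h' : cos (2 * π * a / k) * (q 1 - p 1) - sin (2 * π * a / k) * (q 0 - p 0) = 0 := by
    unfold height at h; linarith
  obtain ⟨e0, e1⟩ := exists_polar_eq h'
  set r := (q 0 - p 0) * cos (2 * π * a / k) + (q 1 - p 1) * sin (2 * π * a / k)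
  rcases lt_trichotomy r 0 with hr | hr | hr
  · refine absurd ⟨-r, by linarith, ?_, ?_⟩ (hP.1 q hq p hp ⟨a, ha⟩)
    · simp only; linarith
    · simp only; linarith
  · rw [hr] at e0 e1
    ext i
    fin_cases i
    · simp only [Fin.zero_eta, Fin.isValue]; linarith
    · simp only [Fin.mk_one, Fin.isValue]; linarith
  · refine absurd ⟨r, hr, ?_, ?_⟩ (hP.1 p hp q hq ⟨a, ha⟩)
    · simp only; linarith
    · simp only; linarith

/-- Sector indices of the points on the positive side of a line in boundary direction `2πb/k`. -/
theorem index_of_height_lt {k b : ℕ} (hb : 2 * b < k) {s : Fin k} {p q : Plane}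
    (hq : q ∈ sector k s p) (h : height k b p < height k b q) :
    b ≤ (s : ℕ) ∧ (s : ℕ) < b + (k + 1) / 2 := by
  obtain ⟨r, θ, hr, hl, hu, h0, h1⟩ := hq
  have hk : (0 : ℝ) < k := by exact_mod_cast s.pos
  have hs : 0 < sin (θ - 2 * π * b / k) := by
    have := height_sub_height (k := k) (a := b) h0 h1
    exact pos_of_mul_pos_right (by linarith) hr.le
  have hbk : 2 * π * b / k < π := by
    rw [div_lt_iff₀ hk]
    have : (2 * b : ℝ) < k := by exact_mod_cast hb
    nlinarith [pi_pos]
  have hb0 : 0 ≤ 2 * π * b / k := by positivity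
  have := sector_angle_nonneg s
  have := sector_angle_le s
  have h2 : 2 * π * b / k < θ := by
    by_contra! hle
    linarith [sin_nonpos_of_nonpos_of_neg_pi_le (x := θ - 2 * π * b / k) (by linarith) (by linarith)]
  have h3 : θ < 2 * π * b / k + π := by
    by_contra! hle
    have := sin_nonneg_of_nonneg_of_le_pi (x := θ - 2 * π * b / k - π) (by linarith) (by linarith)
    rw [sin_sub_pi] at this
    linarith
  have h4 := h2.trans hu
  have h5 := hl.trans_lt h3
  rw [div_lt_div_iff_of_pos_right hk, mul_lt_mul_iff_right₀ (by positivity)] at h4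
  rw [div_add' _ _ _ hk.ne', div_lt_div_iff_of_pos_right hk] at h5
  have h5 : π * (2 * s) < π * (2 * b + k) := by linarith
  have h5 := lt_of_mul_lt_mul_left h5 pi_pos.le
  have h4 : b < (s : ℕ) + 1 := by exact_mod_cast h4
  have h5 : 2 * (s : ℕ) < 2 * b + k := by exact_mod_cast h5
  omega

/-- Sector indices of the points on the negative side of a line in boundary direction `2πb/k`. -/
theorem index_of_height_gt {k b : ℕ} {s : Fin k} {p q : Plane}
    (hq : q ∈ sector k s p) (h : height k b q < height k b p) :
    (s : ℕ) < b ∨ b + k / 2 ≤ (s : ℕ) := by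
  obtain ⟨r, θ, hr, hl, hu, h0, h1⟩ := hq
  have hk : (0 : ℝ) < k := by exact_mod_cast s.pos
  have hs : sin (θ - 2 * π * b / k) < 0 := by
    have := height_sub_height (k := k) (a := b) h0 h1
    by_contra! hle
    nlinarith [mul_nonneg hr.le hle]
  by_contra! hc
  have h2 : 2 * π * b / k ≤ θ := by
    refine le_trans ?_ hl
    have : (b : ℝ) ≤ s := by exact_mod_cast hc.1
    gcongr
  have h3 : θ < 2 * π * b / k + π := by
    refine hu.trans_le ?_
    rw [div_add' _ _ _ hk.ne', div_le_div_iff_of_pos_right hk]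
    have : 2 * ((s : ℕ) + 1) ≤ 2 * b + k := by omega
    have : (2 * ((s : ℝ) + 1)) ≤ 2 * b + k := by exact_mod_cast this
    nlinarith [pi_pos]
  linarith [sin_nonneg_of_nonneg_of_le_pi (x := θ - 2 * π * b / k) (by linarith) (by linarith)]

theorem ncard_seen_le {k D : ℕ} {S : Set Plane} {p : Plane} (I : Finset ℕ) (hI : I.card ≤ D)
    (h : ∀ q ∈ S, ∀ s : Fin k, q ∈ sector k s p → (s : ℕ) ∈ I) : (seen k S p).ncard ≤ D := by
  rw [← Set.ncard_coe_finset] at hI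
  refine le_trans ?_ hI
  refine Set.ncard_le_ncard_of_injOn (fun s : Fin k => (s : ℕ)) ?_ ?_ (Set.toFinite _)
  · rintro s ⟨q, hq, hs⟩
    exact h q hq s hs
  · intro a _ b _ h
    exact Fin.ext h

theorem ncard_seen_of_height_lt {k b : ℕ} (hb : 2 * b < k) {S : Set Plane} {p : Plane}
    (h : ∀ q ∈ S, height k b p < height k b q) : (seen k S p).ncard ≤ (k + 1) / 2 :=
  ncard_seen_le (Finset.Ico b (b + (k + 1) / 2)) (by simp) fun q hq s hs =>
    Finset.mem_Ico.mpr (index_of_height_lt hb hs (h q hq))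

theorem ncard_seen_of_height_gt {k b : ℕ} (hb : 2 * b < k) {S : Set Plane} {p : Plane}
    (h : ∀ q ∈ S, height k b q < height k b p) : (seen k S p).ncard ≤ (k + 1) / 2 := by
  refine ncard_seen_le (Finset.range b ∪ Finset.Ico (b + k / 2) k) ?_ fun q hq s hs => ?_
  · refine (Finset.card_union_le _ _).trans ?_
    rw [Finset.card_range, Nat.card_Ico]
    omega
  · have := index_of_height_gt hs (h q hq)
    rw [Finset.mem_union, Finset.mem_range, Finset.mem_Ico]
    have := s.2
    omega

/-- Signs of the heights are chosen so that the chain is increasing for both. The wedge then meets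
at most `⌈k/2⌉ - b` sectors (same order) or `b` sectors (opposite order); `4b ≤ k` makes the latter
small enough. -/
theorem exists_achievable {k b : ℕ} (hk : 2 ≤ k) (hb : 4 * b ≤ k) (P : Finset Plane)
    (hP : GeneralPosition k (P : Set Plane)) :
    ∃ m c, P.card ≤ m ^ 2 ∧ Achievable k P c ∧ c + b * m ≤ (k + 1) / 2 * P.card := by
  have hb' : 2 * b < k := by omega
  have h0 : 2 * 0 < k := by omega
  have hi0 := injOn_height (a := 0) (by omega) hP
  have hib := injOn_height (a := b) (by omega) hP
  have hneg : ∀ a, Set.InjOn (height k a) P → Set.InjOn (fun q => -height k a q) P :=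
    fun a h p hp q hq e => h hp hq (neg_injective e)
  obtain ⟨C, hC, hcard, hch | hch⟩ := exists_chain P (height k 0) (height k b) hib
  · obtain ⟨c, h1, h2⟩ := achievable_of_chain (k := k) (D := (k + 1) / 2) (b := b)
      (f := fun q => -height k 0 q) (g := fun q => -height k b q) P
      (fun S hS p hp h => ncard_seen_of_height_lt h0 fun q hq => neg_lt_neg_iff.mp (h q hq))
      (fun S hS p hp h => ncard_seen_of_height_lt hb' fun q hq => neg_lt_neg_iff.mp (h q hq))
      (fun S hS p hp h => by
        have : (seen k S p).ncard ≤ (k + 1) / 2 - b := by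
          refine ncard_seen_le (Finset.Ico b ((k + 1) / 2)) (by simp) fun q hq s hs => ?_
          have h1 := index_of_height_lt h0 hs (neg_lt_neg_iff.mp (h q hq).1)
          have h2 := index_of_height_lt hb' hs (neg_lt_neg_iff.mp (h q hq).2)
          rw [Finset.mem_Ico]; omega
        omega)
      (hneg 0 hi0) (hneg b hib) C hC
      (fun p hp q hq h => neg_lt_neg (hch q hq p hp (neg_lt_neg_iff.mp h)))
    exact ⟨C.card, c, hcard, h1, h2⟩
  · obtain ⟨c, h1, h2⟩ := achievable_of_chain (k := k) (D := (k + 1) / 2) (b := b)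
      (f := fun q => -height k 0 q) (g := height k b) P
      (fun S hS p hp h => ncard_seen_of_height_lt h0 fun q hq => neg_lt_neg_iff.mp (h q hq))
      (fun S hS p hp h => ncard_seen_of_height_gt hb' h)
      (fun S hS p hp h => by
        -- For `b = 0` and odd `k` the two index ranges overlap in the middle sector, so the wedge
        -- count fails; nothing has to be saved then.
        rcases Nat.eq_zero_or_pos b with hb0 | hb0
        · rw [hb0]
          exact ncard_seen_of_height_lt h0 fun q hq => neg_lt_neg_iff.mp (h q hq).1
        have : (seen k S p).ncard ≤ b := by
          refine ncard_seen_le (Finset.range b) (by simp) fun q hq s hs => ?_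
          have h1 := index_of_height_lt h0 hs (neg_lt_neg_iff.mp (h q hq).1)
          have h2 := index_of_height_gt hs (h q hq).2
          rw [Finset.mem_range]; omega
        omega)
      (hneg 0 hi0) hib C hC
      (fun p hp q hq h => hch q hq p hp (neg_lt_neg_iff.mp h))
    exact ⟨C.card, c, hcard, h1, h2⟩

theorem e_add_le {k b n : ℕ} (hk : 2 ≤ k) (hb : 4 * b ≤ k) :
    (e k n : ℝ) + b * √n ≤ (n : ℝ) * ((k + 1) / 2 : ℕ) := by
  obtain ⟨P, hP, hgp, hm⟩ := (isGreatest_e (by omega : 1 ≤ k) n).1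
  obtain ⟨m, c, h1, ⟨n', x, ⟨hinj, hran⟩, hc⟩, h2⟩ := exists_achievable hk hb P hgp
  have hn : n' = n := by
    have := Set.ncard_range_of_injective hinj
    rw [hran, Set.ncard_coe_finset, hP] at this
    simpa using this.symm
  subst hn
  have h3 := (hm x ⟨hinj, hran⟩).trans ((edgeCount_le_ncard_slots hinj (hran ▸ hgp)).trans hc)
  have h4 : √n' ≤ m := by
    rw [sqrt_le_left (by positivity)]
    exact_mod_cast hP ▸ h1
  have h5 : (e k n' : ℝ) + b * m ≤ (n' : ℝ) * ((k + 1) / 2 : ℕ) := by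
    rw [hP] at h2
    have : e k n' + b * m ≤ n' * ((k + 1) / 2) := by linarith
    exact_mod_cast this
  nlinarith [mul_le_mul_of_nonneg_left h4 (Nat.cast_nonneg (α := ℝ) b)]

/-! ### Sector membership from two strict inequalities. -/

theorem mem_sector_of_height {k : ℕ} (hk : 2 ≤ k) {s : Fin k} {p q : Plane}
    (h1 : 0 < height k s q - height k s p)
    (h2 : height k (s + 1 : ℕ) q - height k (s + 1 : ℕ) p < 0) : q ∈ sector k s p := by
  have hk0 : (0 : ℝ) < k := by exact_mod_cast s.pos
  have hk2 : (2 : ℝ) ≤ k := by exact_mod_cast hk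
  have hη2 : π / k ≤ π / 2 := by gcongr
  have hη0 : 0 < π / k := by positivity
  set γ : ℝ := 2 * π * s / k + π / k with hγ
  have hγ' : 2 * π * ((s : ℝ) + 1) / k = γ + π / k := by rw [hγ]; ring
  -- The vector `q - p` turned by `-γ`, so that the bisector of the sector becomes the positive real
  -- axis.
  set z : ℂ := ⟨(q 0 - p 0) * cos γ + (q 1 - p 1) * sin γ,
    (q 1 - p 1) * cos γ - (q 0 - p 0) * sin γ⟩ with hz
  set r := ‖z‖
  set ψ := z.arg
  have hre : r * cos ψ = (q 0 - p 0) * cos γ + (q 1 - p 1) * sin γ := Complex.norm_mul_cos_arg z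
  have him : r * sin ψ = (q 1 - p 1) * cos γ - (q 0 - p 0) * sin γ := Complex.norm_mul_sin_arg z
  have hcs := cos_sq_add_sin_sq γ
  have e0 : q 0 = p 0 + r * cos (γ + ψ) := by
    rw [cos_add]
    linear_combination (-(q 0 - p 0)) * hcs - cos γ * hre + sin γ * him
  have e1 : q 1 = p 1 + r * sin (γ + ψ) := by
    rw [sin_add]
    linear_combination (-(q 1 - p 1)) * hcs - cos γ * him - sin γ * hre
  rw [height_sub_height e0 e1, show γ + ψ - 2 * π * s / k = π / k + ψ by rw [hγ]; ring] at h1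
  rw [height_sub_height e0 e1, Nat.cast_add, Nat.cast_one, hγ',
    show γ + ψ - (γ + π / k) = -(π / k - ψ) by ring, sin_neg] at h2
  have hr : 0 ≤ r := norm_nonneg z
  have s1 : 0 < sin (π / k + ψ) := pos_of_mul_pos_right h1 hr
  have s2 : 0 < sin (π / k - ψ) := pos_of_mul_pos_right (by linarith) hr
  have hr' : 0 < r := pos_of_mul_pos_left h1 s1.le
  have hc : 0 < cos ψ := by
    have : 0 < 2 * sin (π / k) * cos ψ := by
      rw [sin_add] at s1; rw [sin_sub] at s2; linarith
    exact pos_of_mul_pos_right this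
      (mul_nonneg zero_le_two (sin_nonneg_of_nonneg_of_le_pi hη0.le (by linarith [pi_pos])))
  have hψ1 : -π < ψ := Complex.neg_pi_lt_arg z
  have hψ2 : ψ ≤ π := Complex.arg_le_pi z
  have hψ3 : |ψ| < π / 2 := by
    by_contra! hle
    rw [← cos_abs] at hc
    exact absurd hc (not_lt.mpr (cos_nonpos_of_pi_div_two_le_of_le hle
      (by linarith [abs_le.mpr ⟨hψ1.le, hψ2⟩, pi_pos])))
  obtain ⟨hψ4, hψ5⟩ := abs_lt.mp hψ3
  refine ⟨r, γ + ψ, hr', ?_, ?_, e0, e1⟩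
  · by_contra! hlt
    linarith [sin_nonpos_of_nonpos_of_neg_pi_le (x := π / k + ψ) (by linarith) (by linarith)]
  · rw [hγ']
    by_contra! hle
    linarith [sin_nonpos_of_nonpos_of_neg_pi_le (x := π / k - ψ) (by linarith) (by linarith)]

theorem not_mem_sector_self {k : ℕ} {s : Fin k} {p : Plane} : p ∉ sector k s p := by
  rintro ⟨r, θ, hr, -, -, h0, h1⟩
  have h0 : cos θ = 0 := (mul_eq_zero.mp (by linarith : r * cos θ = 0)).resolve_left hr.ne'
  have h1 : sin θ = 0 := (mul_eq_zero.mp (by linarith : r * sin θ = 0)).resolve_left hr.ne'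
  have := cos_sq_add_sin_sq θ
  rw [h0, h1] at this
  norm_num at this

/-! ### A perturbed lattice in general position. -/

/-- A perturbation of the integer lattice, depending polynomially on `τ`. -/
noncomputable def latticePt (τ : ℝ) (v : ℤ × ℤ) : Plane :=
  !₂[v.1 - τ * v.2, v.2 + τ * v.1 + τ ^ 2 * v.2]

theorem latticePt_zero_coord (τ : ℝ) (v : ℤ × ℤ) : latticePt τ v 0 = v.1 - τ * v.2 := by
  simp [latticePt]

theorem latticePt_one_coord (τ : ℝ) (v : ℤ × ℤ) :
    latticePt τ v 1 = v.2 + τ * v.1 + τ ^ 2 * v.2 := by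
  simp [latticePt]

theorem latticePt_sub (τ : ℝ) (v w : ℤ × ℤ) : latticePt τ (v - w) = latticePt τ v - latticePt τ w := by
  ext i
  fin_cases i
  · simp [latticePt_zero_coord]; ring
  · simp [latticePt_one_coord]; ring

theorem finite_zeros_quartic {c₀ c₁ c₂ c₃ c₄ : ℝ}
    (h : ¬(c₀ = 0 ∧ c₁ = 0 ∧ c₂ = 0 ∧ c₃ = 0 ∧ c₄ = 0)) :
    {τ : ℝ | c₀ + c₁ * τ + c₂ * τ ^ 2 + c₃ * τ ^ 3 + c₄ * τ ^ 4 = 0}.Finite := by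
  let P : Polynomial ℝ := .C c₀ + .C c₁ * .X + .C c₂ * .X ^ 2 + .C c₃ * .X ^ 3 + .C c₄ * .X ^ 4
  have hP : P ≠ 0 := by
    intro h0
    refine h ⟨?_, ?_, ?_, ?_, ?_⟩
    · simpa [P, Polynomial.coeff_X, Polynomial.coeff_C] using congrArg (Polynomial.coeff · 0) h0
    · simpa [P, Polynomial.coeff_X, Polynomial.coeff_C, Polynomial.coeff_X_pow] using
        congrArg (Polynomial.coeff · 1) h0
    · simpa [P, Polynomial.coeff_X, Polynomial.coeff_C, Polynomial.coeff_X_pow] using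
        congrArg (Polynomial.coeff · 2) h0
    · simpa [P, Polynomial.coeff_X, Polynomial.coeff_C, Polynomial.coeff_X_pow] using
        congrArg (Polynomial.coeff · 3) h0
    · simpa [P, Polynomial.coeff_X, Polynomial.coeff_C, Polynomial.coeff_X_pow] using
        congrArg (Polynomial.coeff · 4) h0
  refine (Polynomial.finite_setOfPred_isRoot hP).subset fun τ hτ => ?_
  simpa [P, Polynomial.IsRoot] using hτ

theorem height_latticePt (k i : ℕ) (τ : ℝ) (v : ℤ × ℤ) :
    height k i (latticePt τ v) = cos (2 * π * i / k) * (v.2 + τ * v.1 + τ ^ 2 * v.2) -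
      sin (2 * π * i / k) * (v.1 - τ * v.2) := by
  rw [height, latticePt_zero_coord, latticePt_one_coord]

theorem countable_height_eq_zero (k : ℕ) :
    {τ : ℝ | ∃ v : ℤ × ℤ, ∃ i : ℕ, v ≠ 0 ∧ height k i (latticePt τ v) = 0}.Countable := by
  have : {τ : ℝ | ∃ v : ℤ × ℤ, ∃ i : ℕ, v ≠ 0 ∧ height k i (latticePt τ v) = 0} =
      ⋃ (v : ℤ × ℤ) (i : ℕ), {τ : ℝ | v ≠ 0 ∧ height k i (latticePt τ v) = 0} := by
    ext; simp
  rw [this]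
  refine Set.countable_iUnion fun v => Set.countable_iUnion fun i => Set.Finite.countable ?_
  by_cases hv : v = 0
  · simp [hv]
  set α := 2 * π * i / k with hα
  have hcs := cos_sq_add_sin_sq α
  -- The first two coefficients are the coordinates of `v` after a rotation, so they vanish together
  -- only for `v = 0`.
  refine (finite_zeros_quartic (c₀ := cos α * v.2 - sin α * v.1) (c₁ := cos α * v.1 + sin α * v.2)
    (c₂ := cos α * v.2) (c₃ := 0) (c₄ := 0) ?_).subset ?_
  · rintro ⟨h0, h1, -⟩
    refine hv (Prod.ext ?_ ?_)
    · have : (v.1 : ℝ) = 0 := by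
        linear_combination -(v.1 : ℝ) * hcs - sin α * h0 + cos α * h1
      exact_mod_cast this
    · have : (v.2 : ℝ) = 0 := by
        linear_combination -(v.2 : ℝ) * hcs + cos α * h0 + sin α * h1
      exact_mod_cast this
  · rintro τ ⟨-, h⟩
    rw [height_latticePt, ← hα] at h
    simp only [Set.mem_ofPred_eq]
    linear_combination h

theorem dist_latticePt_sq (τ : ℝ) (v w : ℤ × ℤ) :
    dist (latticePt τ v) (latticePt τ w) ^ 2 = ((w - v).1 - τ * (w - v).2 : ℝ) ^ 2 +
      ((w - v).2 + τ * (w - v).1 + τ ^ 2 * (w - v).2) ^ 2 := by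
  rw [dist_comm, dist_eq_norm, ← latticePt_sub, EuclideanSpace.norm_sq_eq, Fin.sum_univ_two,
    latticePt_zero_coord, latticePt_one_coord, norm_eq_abs, norm_eq_abs, sq_abs, sq_abs]

theorem eq_or_eq_neg_of_forms {v w : ℤ × ℤ} (h1 : v.1 ^ 2 + v.2 ^ 2 = w.1 ^ 2 + w.2 ^ 2)
    (h2 : v.1 * v.2 = w.1 * w.2) (h3 : v.2 ^ 2 = w.2 ^ 2) : v = w ∨ v = -w := by
  obtain ⟨a, b⟩ := v
  obtain ⟨c, d⟩ := w
  simp only [Prod.mk.injEq, Prod.neg_mk] at *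
  have h4 : a ^ 2 = c ^ 2 := by linarith
  rcases sq_eq_sq_iff_eq_or_eq_neg.mp h3 with rfl | rfl
  · rcases sq_eq_sq_iff_eq_or_eq_neg.mp h4 with rfl | rfl
    · simp
    · rcases eq_or_ne b 0 with rfl | hb
      · simp
      · have := mul_right_cancel₀ hb h2
        exact Or.inl ⟨this, rfl⟩
  · rcases eq_or_ne d 0 with rfl | hd
    · rcases sq_eq_sq_iff_eq_or_eq_neg.mp h4 with rfl | rfl <;> simp
    · have : -a = c := mul_right_cancel₀ hd (by linarith)
      exact Or.inr ⟨by omega, rfl⟩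

/-- The term `τ ^ 2 * v.2` in `latticePt` prevents it from being a similarity, which would keep all
distance ties. With it, the coefficients of the squared length determine `v` up to sign. -/
theorem countable_dist_eq :
    {τ : ℝ | ∃ v w : ℤ × ℤ, ¬(v = w ∨ v = -w) ∧
      (v.1 - τ * v.2 : ℝ) ^ 2 + (v.2 + τ * v.1 + τ ^ 2 * v.2) ^ 2 =
      (w.1 - τ * w.2 : ℝ) ^ 2 + (w.2 + τ * w.1 + τ ^ 2 * w.2) ^ 2}.Countable := by
  have : {τ : ℝ | ∃ v w : ℤ × ℤ, ¬(v = w ∨ v = -w) ∧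
      (v.1 - τ * v.2 : ℝ) ^ 2 + (v.2 + τ * v.1 + τ ^ 2 * v.2) ^ 2 =
      (w.1 - τ * w.2 : ℝ) ^ 2 + (w.2 + τ * w.1 + τ ^ 2 * w.2) ^ 2} =
      ⋃ (v : ℤ × ℤ) (w : ℤ × ℤ), {τ : ℝ | ¬(v = w ∨ v = -w) ∧
      (v.1 - τ * v.2 : ℝ) ^ 2 + (v.2 + τ * v.1 + τ ^ 2 * v.2) ^ 2 =
      (w.1 - τ * w.2 : ℝ) ^ 2 + (w.2 + τ * w.1 + τ ^ 2 * w.2) ^ 2} := by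
    ext
    simp only [Set.mem_ofPred_eq, Set.mem_iUnion]
  rw [this]
  refine Set.countable_iUnion fun v => Set.countable_iUnion fun w => Set.Finite.countable ?_
  by_cases hvw : v = w ∨ v = -w
  · simp [hvw]
  refine (finite_zeros_quartic (c₀ := (v.1 ^ 2 + v.2 ^ 2 - (w.1 ^ 2 + w.2 ^ 2) : ℤ)) (c₁ := 0)
    (c₂ := (v.1 ^ 2 + 3 * v.2 ^ 2 - (w.1 ^ 2 + 3 * w.2 ^ 2) : ℤ))
    (c₃ := (2 * (v.1 * v.2) - 2 * (w.1 * w.2) : ℤ)) (c₄ := (v.2 ^ 2 - w.2 ^ 2 : ℤ)) ?_).subset ?_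
  · rintro ⟨h0, -, -, h3, h4⟩
    norm_cast at h0 h3 h4
    exact hvw (eq_or_eq_neg_of_forms (by omega) (by omega) (by omega))
  · rintro τ ⟨-, h⟩
    simp only [Set.mem_ofPred_eq]
    push_cast
    linear_combination h

/-- Only countably many `τ` are bad, so good ones exist arbitrarily near `0`. The remaining ties,
between `v` and `-v`, are harmless since opposite vectors never share a sector. -/
theorem exists_generic (k : ℕ) (hk : 2 ≤ k) {p : ℝ → Prop} (hp : ∀ᶠ τ in 𝓝 0, p τ) :
    ∃ τ, p τ ∧ Function.Injective (latticePt τ) ∧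
      GeneralPosition k (Set.range (latticePt τ)) := by
  obtain ⟨τ, h1, h2⟩ := ((countable_height_eq_zero k).union
    countable_dist_eq).dense_compl ℝ |>.inter_nhds_nonempty hp
  rw [Set.mem_compl_iff, Set.mem_union, not_or] at h1
  obtain ⟨hh, hd⟩ := h1
  have hh : ∀ v : ℤ × ℤ, ∀ i : ℕ, height k i (latticePt τ v) = 0 → v = 0 := by
    intro v i h
    by_contra hv
    exact hh ⟨v, i, hv, h⟩
  have hsub : ∀ v w i, latticePt τ v i - latticePt τ w i = latticePt τ (v - w) i := by
    intro v w i
    rw [latticePt_sub]; rfl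
  refine ⟨τ, h2, ?_, ?_, ?_⟩
  · intro v w hvw
    have : latticePt τ (v - w) = 0 := by rw [latticePt_sub, hvw, sub_self]
    exact sub_eq_zero.mp (hh _ 0 (by rw [this]; simp [height]))
  · rintro _ ⟨v, rfl⟩ _ ⟨w, rfl⟩ i ⟨r, hr, h0, h1⟩
    have := height_sub_height (k := k) (a := i) h0 h1
    rw [sub_self, sin_zero, mul_zero] at this
    have hz : w - v = 0 := by
      refine hh _ i ?_
      rw [← this]
      simp only [height, ← hsub]
      ring
    rw [sub_eq_zero.mp hz] at h0 h1
    have c0 := (mul_eq_zero.mp (by linarith : r * cos (2 * π * i / k) = 0)).resolve_left hr.ne'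
    have c1 := (mul_eq_zero.mp (by linarith : r * sin (2 * π * i / k) = 0)).resolve_left hr.ne'
    have := cos_sq_add_sin_sq (2 * π * i / k)
    rw [c0, c1] at this
    norm_num at this
  · rintro _ ⟨u, rfl⟩ _ ⟨v, rfl⟩ _ ⟨w, rfl⟩ i hv hw h
    have h := congrArg (· ^ 2) h
    simp only [dist_latticePt_sq] at h
    by_contra hne
    have : v - u = w - u ∨ v - u = -(w - u) := by
      by_contra hc
      exact hd ⟨v - u, w - u, hc, h⟩
    rcases this with h1 | h1
    · exact hne (by rw [sub_left_inj.mp h1])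
    · have hneg : ∀ a, latticePt τ (-a) = -latticePt τ a := by
        intro a
        have h0 : latticePt τ 0 = 0 := by simpa using latticePt_sub τ 0 0
        rw [← zero_sub, latticePt_sub, h0, zero_sub]
      refine neg_not_mem_sector hk hv hw ?_ ?_ <;>
      · rw [hsub, hsub, h1, hneg]; rfl

/-! ### The polygon gadget. -/

/-- Rounded vertices of a regular `k`-gon. -/
noncomputable def polygonVec (k j : ℕ) : ℤ × ℤ :=
  (round (-(2 * k * cos (2 * π * j / k + π / k))), round (-(2 * k * sin (2 * π * j / k + π / k))))

theorem polygonVec_mod (k j : ℕ) : polygonVec k (j % k) = polygonVec k j := by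
  rcases Nat.eq_zero_or_pos k with rfl | hk
  · simp
  have hk0 : (k : ℝ) ≠ 0 := by positivity
  have : 2 * π * j / k + π / k = 2 * π * (j % k : ℕ) / k + π / k + (j / k : ℕ) * (2 * π) := by
    have h : (j : ℝ) = k * (j / k : ℕ) + (j % k : ℕ) := by exact_mod_cast (Nat.div_add_mod j k).symm
    rw [h]
    field_simp
    ring
  rw [polygonVec, polygonVec, this, cos_add_nat_mul_two_pi, sin_add_nat_mul_two_pi]

theorem abs_polygonVec_le (k j : ℕ) :
    |(polygonVec k j).1| ≤ 2 * k ∧ |(polygonVec k j).2| ≤ 2 * k := by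
  have key : ∀ c : ℝ, |c| ≤ 1 → |round (-(2 * k * c))| ≤ (2 * k : ℤ) := by
    intro c hc
    obtain ⟨h1, h2⟩ := abs_le.mp hc
    have hk : (0 : ℝ) ≤ 2 * k := by positivity
    rw [abs_le]
    have e1 : round (-(2 * k : ℝ)) = -(2 * k : ℤ) := by exact_mod_cast round_intCast (α := ℝ) (-(2 * k : ℤ))
    have e2 : round (2 * k : ℝ) = (2 * k : ℤ) := by exact_mod_cast round_natCast (α := ℝ) (2 * k)
    rw [← e1, ← e2]
    rw [round_eq, round_eq, round_eq]
    constructor <;> apply Int.floor_mono <;> nlinarith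
  exact ⟨key _ (abs_cos_le_one _), key _ (abs_sin_le_one _)⟩

/-- Vertex `j` lies opposite to the bisector of sector `j`, so that sector points across the
polygon. Radius `2k` gives a margin of at least `4` before rounding, of which rounding costs at most
`2`. Strictness lets the inequalities survive small `τ`. -/
theorem height_polygonVec {k h : ℕ} (hk : 2 ≤ k) (h1 : k ≤ 2 * h + 1) (h2 : 2 * h ≤ k + 1) (j : ℕ) :
    0 < height k j (latticePt 0 (polygonVec k (j + h) - polygonVec k j)) ∧
    height k (j + 1 : ℕ) (latticePt 0 (polygonVec k (j + h) - polygonVec k j)) < 0 := by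
  have hk0 : (0 : ℝ) < k := by positivity
  have hk2 : (2 : ℝ) ≤ k := by exact_mod_cast hk
  have h1' : (k : ℝ) ≤ 2 * h + 1 := by exact_mod_cast h1
  have h2' : (2 : ℝ) * h ≤ k + 1 := by exact_mod_cast h2
  have hη : π / k ≤ π / 2 := by gcongr
  have hsin : 4 ≤ 2 * k * sin (π / k) := by
    have := mul_le_sin (x := π / k) (by positivity) hη
    have e : 2 / π * (π / k) = 2 / k := by field_simp
    rw [e, div_le_iff₀ hk0] at this
    linarith
  have hbound : ∀ β x y : ℝ, 4 ≤ 2 * k * (sin (y - β) - sin (x - β)) →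
      2 ≤ cos β * (round (-(2 * k * sin x)) - round (-(2 * k * sin y)) : ℝ) -
        sin β * (round (-(2 * k * cos x)) - round (-(2 * k * cos y)) : ℝ) := by
    intro β x y h
    have r1 := abs_le.mp (abs_sub_round (-(2 * k * sin x)))
    have r2 := abs_le.mp (abs_sub_round (-(2 * k * sin y)))
    have r3 := abs_le.mp (abs_sub_round (-(2 * k * cos x)))
    have r4 := abs_le.mp (abs_sub_round (-(2 * k * cos y)))
    set A : ℝ := round (-(2 * k * sin x)) - round (-(2 * k * sin y)) with hA
    set B : ℝ := round (-(2 * k * cos x)) - round (-(2 * k * cos y)) with hB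
    have a1 : |A - (2 * k * sin y - 2 * k * sin x)| ≤ 1 := abs_le.mpr ⟨by linarith, by linarith⟩
    have b1 : |B - (2 * k * cos y - 2 * k * cos x)| ≤ 1 := abs_le.mpr ⟨by linarith, by linarith⟩
    have a2 : |cos β * (A - (2 * k * sin y - 2 * k * sin x))| ≤ 1 := by
      rw [abs_mul]; exact mul_le_one₀ (abs_cos_le_one _) (abs_nonneg _) a1
    have b2 : |sin β * (B - (2 * k * cos y - 2 * k * cos x))| ≤ 1 := by
      rw [abs_mul]; exact mul_le_one₀ (abs_sin_le_one _) (abs_nonneg _) b1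
    rw [sin_sub, sin_sub] at h
    linarith [(abs_le.mp a2).1, (abs_le.mp b2).2]
  set y := 2 * π * j / k + π / k with hy
  set x := 2 * π * (j + h : ℕ) / k + π / k with hx
  have b1 := hbound (2 * π * j / k) x y (by
    have e1 : y - 2 * π * j / k = π / k := by rw [hy]; ring
    have e2 : x - 2 * π * j / k - π = π / k * (2 * h + 1 - k) := by
      rw [hx]; push_cast; field_simp; ring
    have e3 := sin_nonneg_of_nonneg_of_le_pi (x := π / k * (2 * h + 1 - k))
      (mul_nonneg (by positivity) (by linarith)) (by
        have := mul_le_mul_of_nonneg_left (by linarith : (2 * h + 1 - k : ℝ) ≤ 2)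
          (by positivity : 0 ≤ π / k)
        linarith)
    rw [← e2, sin_sub_pi] at e3
    rw [e1]
    nlinarith)
  have b2 := hbound (2 * π * (j + 1 : ℕ) / k) y x (by
    have e1 : y - 2 * π * (j + 1 : ℕ) / k = -(π / k) := by rw [hy]; push_cast; ring
    have e2 : π - (x - 2 * π * (j + 1 : ℕ) / k) = π / k * (k + 1 - 2 * h) := by
      rw [hx]; push_cast; field_simp; ring
    have e3 := sin_nonneg_of_nonneg_of_le_pi (x := π / k * (k + 1 - 2 * h))
      (mul_nonneg (by positivity) (by linarith)) (by
        have := mul_le_mul_of_nonneg_left (by linarith : (k + 1 - 2 * h : ℝ) ≤ 2)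
          (by positivity : 0 ≤ π / k)
        linarith)
    rw [← e2, sin_pi_sub] at e3
    rw [e1, sin_neg]
    nlinarith)
  rw [height_latticePt, height_latticePt]
  simp only [polygonVec, Prod.fst_sub, Prod.snd_sub, Int.cast_sub, ← hx, ← hy, zero_mul,
    add_zero, sub_zero, ne_eq, OfNat.ofNat_ne_zero, not_false_eq_true, zero_pow]
  constructor <;> linarith

/-- Lattices in general position whose polygon vectors point into prescribed sectors. -/
theorem exists_lattice_config {k : ℕ} (hk : 2 ≤ k) :
    ∃ (φ : ℤ × ℤ → Plane) (w : Fin k → ℤ × ℤ) (σ : Fin k → Fin k), Function.Injective φ ∧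
      GeneralPosition k (Set.range φ) ∧ Function.Injective σ ∧
      (∀ j, |(w j).1| ≤ 2 * k ∧ |(w j).2| ≤ 2 * k) ∧
      ∀ t j, φ (t + w (σ j)) ∈ sector k j (φ (t + w j)) ∧
        φ (t + w j) ∈ sector k (σ j) (φ (t + w (σ j))) := by
  have hpos : 0 < k := by omega
  have hcont : ∀ (i : ℕ) (v : ℤ × ℤ), Continuous fun τ => height k i (latticePt τ v) := by
    intro i v
    simp only [height_latticePt]
    fun_prop
  have hev : ∀ h, k ≤ 2 * h + 1 → 2 * h ≤ k + 1 → ∀ᶠ τ in 𝓝 (0 : ℝ), ∀ j : Fin k,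
      0 < height k j (latticePt τ (polygonVec k (j + h) - polygonVec k j)) ∧
      height k (j + 1 : ℕ) (latticePt τ (polygonVec k (j + h) - polygonVec k j)) < 0 := by
    intro h h1 h2
    refine eventually_all.mpr fun j => ?_
    obtain ⟨a, b⟩ := height_polygonVec hk h1 h2 j
    exact ((hcont _ _).continuousAt.eventually_const_lt a).and
      ((hcont _ _).continuousAt.eventually_lt_const b)
  -- Going forth by `⌊k/2⌋` and back by `⌈k/2⌉` closes up modulo `k`, also for odd `k`.
  obtain ⟨τ, ⟨h1, h2⟩, hinj, hgp⟩ := exists_generic k hk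
    ((hev (k / 2) (by omega) (by omega)).and (hev ((k + 1) / 2) (by omega) (by omega)))
  have hmem : ∀ h (j : Fin k),
      0 < height k j (latticePt τ (polygonVec k (j + h) - polygonVec k j)) ∧
      height k (j + 1 : ℕ) (latticePt τ (polygonVec k (j + h) - polygonVec k j)) < 0 →
      ∀ t, latticePt τ (t + polygonVec k (j + h)) ∈
        sector k j (latticePt τ (t + polygonVec k j)) := by
    intro h j hj t
    have : ∀ i : ℕ, height k i (latticePt τ (t + polygonVec k (j + h))) -
        height k i (latticePt τ (t + polygonVec k j)) =
        height k i (latticePt τ (polygonVec k (j + h) - polygonVec k j)) := by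
      intro i
      simp only [height_latticePt, Prod.fst_sub, Prod.snd_sub, Prod.fst_add, Prod.snd_add]
      push_cast
      ring
    refine mem_sector_of_height hk ?_ ?_
    · rw [this]; exact hj.1
    · rw [this]; exact hj.2
  refine ⟨latticePt τ, fun j => polygonVec k j,
    fun j => ⟨(j + k / 2) % k, Nat.mod_lt _ hpos⟩, hinj, hgp, ?_,
    fun j => abs_polygonVec_le k j, fun t j => ⟨?_, ?_⟩⟩
  · intro a b hab
    have : (a : ℕ) + k / 2 ≡ b + k / 2 [MOD k] := Fin.ext_iff.mp hab
    have := Nat.ModEq.add_right_cancel' _ this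
    exact Fin.ext (Nat.ModEq.eq_of_lt_of_lt this a.2 b.2)
  · have := hmem _ j (h1 j) t
    simp only [polygonVec_mod]
    exact this
  · have := hmem _ ⟨(j + k / 2) % k, Nat.mod_lt _ hpos⟩ (h2 _) t
    have e : polygonVec k ((j + k / 2) % k + (k + 1) / 2) = polygonVec k j := by
      rw [← polygonVec_mod k ((j + k / 2) % k + (k + 1) / 2), Nat.mod_add_mod,
        show (j : ℕ) + k / 2 + (k + 1) / 2 = j + k by omega, Nat.add_mod_right, polygonVec_mod]
    rwa [e] at this

/-! ### Counting gadgets and the lower bound. -/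

open Classical in
/-- In every order, each gadget that lies in the point set fills at least `⌈k/2⌉` slots. -/
theorem mul_card_le_ncard_slots {k n : ℕ} {φ : ℤ × ℤ → Plane} {w : Fin k → ℤ × ℤ}
    {σ : Fin k → Fin k} (hφ : Function.Injective φ) (hσ : Function.Injective σ)
    (hw : ∀ t j, φ (t + w (σ j)) ∈ sector k j (φ (t + w j)) ∧
        φ (t + w j) ∈ sector k (σ j) (φ (t + w (σ j))))
    (A T : Finset (ℤ × ℤ)) (hT : ∀ t ∈ T, ∀ j, t + w j ∈ A) (hn : 0 < n) {x : Fin n → Plane}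
    (hx : ∀ v ∈ A, φ v ∈ Set.range x) : (k + 1) / 2 * T.card ≤ (slots k x).ncard := by
  have : Nonempty (Fin n) := ⟨⟨0, hn⟩⟩
  choose! idx hidx using hx
  let good : ℤ × ℤ → Finset (Fin k) := fun t =>
    Finset.univ.filter fun j => (idx (t + w j), j) ∈ slots k x
  have hgood : ∀ t ∈ T, (k + 1) / 2 ≤ (good t).card := by
    intro t ht
    let U : Finset (Fin k) := (good t)ᶜ
    have hdisj : Disjoint U (U.image σ) := by
      rw [Finset.disjoint_left]
      intro j' hj' hj
      obtain ⟨j, hjU, rfl⟩ := Finset.mem_image.mp hj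
      simp only [U, good, Finset.mem_compl, Finset.mem_filter, Finset.mem_univ, true_and] at hjU hj'
      obtain ⟨m1, m2⟩ := hw t j
      rw [← hidx _ (hT t ht j), ← hidx _ (hT t ht (σ j))] at m1 m2
      rcases lt_trichotomy (idx (t + w j)) (idx (t + w (σ j))) with h | h | h
      · exact hj' ⟨_, h, m2⟩
      · rw [h] at m1
        exact not_mem_sector_self m1
      · exact hjU ⟨_, h, m1⟩
    have h1 := Finset.card_union_of_disjoint hdisj
    rw [Finset.card_image_of_injective _ hσ] at h1
    have h2 := Finset.card_le_univ (U ∪ U.image σ)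
    have h3 := Finset.card_add_card_compl (good t)
    rw [Fintype.card_fin] at h2 h3
    change _ + U.card = k at h3
    omega
  have h1 : T.card * ((k + 1) / 2) ≤ (T.sigma good).card := by
    rw [Finset.card_sigma]
    exact Finset.card_nsmul_le_sum T _ _ hgood
  rw [mul_comm]
  refine h1.trans ?_
  rw [← Set.ncard_coe_finset]
  -- The sector index of a slot names the polygon vertex, and subtracting that vertex recovers the
  -- translate.
  refine Set.ncard_le_ncard_of_injOn (fun a => (idx (a.1 + w a.2), a.2)) ?_ ?_ (Set.toFinite _)
  · rintro ⟨t, j⟩ h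
    obtain ⟨-, h⟩ := Finset.mem_sigma.mp (Finset.mem_coe.mp h)
    exact (Finset.mem_filter.mp h).2
  · rintro ⟨t, j⟩ ha ⟨t', j'⟩ hb h
    obtain ⟨ha, -⟩ := Finset.mem_sigma.mp (Finset.mem_coe.mp ha)
    obtain ⟨hb, -⟩ := Finset.mem_sigma.mp (Finset.mem_coe.mp hb)
    simp only [Prod.mk.injEq] at h
    obtain ⟨h, rfl⟩ := h
    have e1 := hidx _ (hT t ha j)
    rw [h, hidx _ (hT t' hb j)] at e1
    rw [add_right_cancel (hφ e1)]

/-- `n` lattice points that contain almost `n` translates of a bounded pattern. -/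
theorem exists_finset_translates (n W : ℕ) : ∃ A T : Finset (ℤ × ℤ), A.card = n ∧
    (∀ t ∈ T, ∀ w : ℤ × ℤ, |w.1| ≤ W → |w.2| ≤ W → t + w ∈ A) ∧
    (n : ℝ) - (4 * W + 2) * √n ≤ T.card := by
  set m := n.sqrt
  have hm1 : m * m ≤ n := Nat.sqrt_le n
  have hm2 : n ≤ m * m + m + m := Nat.sqrt_le_add n
  let box : ℕ → Finset (ℤ × ℤ) := fun m => Finset.Ico (0 : ℤ) m ×ˢ Finset.Ico (0 : ℤ) m
  have hbox : ∀ m, (box m).card = m * m := by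
    intro m
    simp [box]
  have hsub : box m ⊆ box (m + 1) := by
    refine Finset.product_subset_product ?_ ?_ <;>
      exact Finset.Ico_subset_Ico_right (by push_cast; omega)
  obtain ⟨A, hA1, -, hA⟩ := Finset.exists_subsuperset_card_eq (n := n) hsub
    (by rw [hbox]; exact hm1) (by rw [hbox]; linarith)
  refine ⟨A, Finset.Ico (W : ℤ) (m - W) ×ˢ Finset.Ico (W : ℤ) (m - W), hA, ?_, ?_⟩
  · rintro ⟨a, b⟩ ht ⟨c, d⟩ hc hd
    refine hA1 ?_
    simp only [box, Finset.mem_product, Finset.mem_Ico, Prod.mk_add_mk] at *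
    rw [abs_le] at hc hd
    omega
  · rw [Finset.card_product, Int.card_Ico]
    have hm3 : (m : ℝ) ≤ √n := by
      rw [le_sqrt (by positivity) (by positivity), sq]
      exact_mod_cast hm1
    have hm2 : (n : ℝ) ≤ m * m + m + m := by exact_mod_cast hm2
    -- The margin of width `W` costs `4Wm`; the points outside the `m × m` box cost at most `2m`.
    have h1 : (n : ℝ) - (4 * W + 2) * √n ≤ m * m - 4 * W * m := by
      nlinarith [mul_le_mul_of_nonneg_left hm3 (by positivity : (0 : ℝ) ≤ 4 * W + 2)]
    refine h1.trans ?_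
    rcases le_total (2 * W) m with h | h
    · have : ((m : ℤ) - W - W).toNat = m - 2 * W := by omega
      rw [this, Nat.cast_mul, Nat.cast_sub h]
      push_cast
      nlinarith [sq_nonneg (W : ℝ)]
    · have : (m : ℝ) ≤ 2 * W := by exact_mod_cast h
      have h0 : (m : ℝ) * m - 4 * W * m ≤ 0 := by nlinarith [Nat.cast_nonneg (α := ℝ) m]
      exact h0.trans (by positivity)

theorem le_e {k : ℕ} (hk : 2 ≤ k) (n : ℕ) :
    (n : ℝ) * ((k + 1) / 2 : ℕ) - ((k + 1) / 2 : ℕ) * (8 * k + 2) * √n ≤ e k n := by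
  rcases Nat.eq_zero_or_pos n with rfl | hn
  · simp
  obtain ⟨φ, w, σ, hφ, hgp, hσ, hwb, hw⟩ := exists_lattice_config hk
  obtain ⟨A, T, hA, hT, hcard⟩ := exists_finset_translates n (2 * k)
  have hmem : (k + 1) / 2 * T.card ∈ unavoidable k n := by
    refine ⟨A.map ⟨φ, hφ⟩, by rw [Finset.card_map, hA], ?_, ?_⟩
    · have hsub : ((A.map ⟨φ, hφ⟩ : Finset Plane) : Set Plane) ⊆ Set.range φ := by
        rw [Finset.coe_map]
        exact Set.image_subset_range _ _
      exact ⟨fun p hp q hq => hgp.1 p (hsub hp) q (hsub hq),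
        fun p hp q hq r hr => hgp.2 p (hsub hp) q (hsub hq) r (hsub hr)⟩
    · rintro x ⟨-, hran⟩
      refine (mul_card_le_ncard_slots hφ hσ hw A T (fun t ht j => hT t ht (w j) ?_ ?_) hn
        fun v hv => ?_).trans (ncard_slots_le_edgeCount k x)
      · exact_mod_cast (hwb j).1
      · exact_mod_cast (hwb j).2
      · rw [hran]
        exact Finset.mem_coe.mpr (Finset.mem_map_of_mem ⟨φ, hφ⟩ hv)
  have h1 : (k + 1) / 2 * T.card ≤ e k n := (isGreatest_e (by omega) n).2 hmem
  have h2 : (((k + 1) / 2 : ℕ) : ℝ) * T.card ≤ e k n := by exact_mod_cast h1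
  have h3 := mul_le_mul_of_nonneg_left hcard (Nat.cast_nonneg (α := ℝ) ((k + 1) / 2))
  push_cast at h3
  linarith

theorem natCeil_half (k : ℕ) : ⌈(k : ℝ) / 2⌉₊ = (k + 1) / 2 := by
  have h1 : 2 * ((k + 1) / 2) ≤ k + 1 := by omega
  have h2 : k ≤ 2 * ((k + 1) / 2) := by omega
  refine le_antisymm (Nat.ceil_le.mpr ?_) ?_
  · rw [div_le_iff₀ two_pos, mul_comm]
    exact_mod_cast h2
  · have := Nat.le_ceil ((k : ℝ) / 2)
    rw [div_le_iff₀ two_pos] at this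
    have : k ≤ ⌈(k : ℝ) / 2⌉₊ * 2 := by exact_mod_cast this
    omega

end OrderedYao

/-! ### The asymptotic statements. -/

theorem mainTheorem3 :
    (∀ k : ℕ, 2 ≤ k →
      (fun n : ℕ => (OrderedYao.e k n : ℝ) - (n : ℝ) * (⌈(k : ℝ) / 2⌉₊ : ℝ))
        =o[atTop] (fun n : ℕ => (n : ℝ))) ∧
    (∃ C : ℝ, 0 < C ∧ ∀ k : ℕ, 4 ≤ k → ∀ n : ℕ,
      (n : ℝ) * (⌈(k : ℝ) / 2⌉₊ : ℝ) - C * ((k : ℝ) ^ 3 * √(n : ℝ)) ≤ (OrderedYao.e k n : ℝ)) ∧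
    (∃ c : ℝ, 0 < c ∧ ∀ k : ℕ, 4 ≤ k → ∀ n : ℕ,
      (OrderedYao.e k n : ℝ) ≤ (n : ℝ) * (⌈(k : ℝ) / 2⌉₊ : ℝ) - c * ((k : ℝ) * √(n : ℝ))) := by
  -- `1 / 8` comes from `⌊k/4⌋ ≥ k/8` for `k ≥ 4`. The lower bound in fact loses only `O(k²√n)`, so
  -- `10` is generous.
  refine ⟨fun k hk => ?_, ⟨10, by norm_num, fun k hk n => ?_⟩, 1 / 8, by norm_num, fun k hk n => ?_⟩
  · have hO : (fun n : ℕ => (OrderedYao.e k n : ℝ) - (n : ℝ) * (⌈(k : ℝ) / 2⌉₊ : ℝ))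
        =O[atTop] (fun n : ℕ => √(n : ℝ)) := by
      refine IsBigO.of_bound (((k + 1) / 2 : ℕ) * (8 * k + 2)) (.of_forall fun n => ?_)
      have h1 := OrderedYao.le_e hk n
      have h2 := OrderedYao.e_add_le (b := 0) (n := n) hk (by omega)
      rw [OrderedYao.natCeil_half, Real.norm_eq_abs, Real.norm_of_nonneg (Real.sqrt_nonneg _),
        abs_of_nonpos (by simp at h2; linarith)]
      linarith
    refine hO.trans_isLittleO ?_
    have h : (fun n : ℕ => √(n : ℝ)) =o[atTop] fun n : ℕ => √(n : ℝ) * √(n : ℝ) := by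
      have h1 : Tendsto (fun n : ℕ => √(n : ℝ)) atTop atTop :=
        Real.tendsto_sqrt_atTop.comp tendsto_natCast_atTop_atTop
      simpa using (isBigO_refl (fun n : ℕ => √(n : ℝ)) atTop).mul_isLittleO
        ((isLittleO_const_left_of_ne (one_ne_zero (α := ℝ))).mpr
          (tendsto_norm_atTop_atTop.comp h1))
    simpa using h
  · rw [OrderedYao.natCeil_half]
    have h1 := OrderedYao.le_e (by omega : 2 ≤ k) n
    refine le_trans (sub_le_sub_left ?_ _) h1
    rw [← mul_assoc]
    refine mul_le_mul_of_nonneg_right ?_ (Real.sqrt_nonneg _)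
    have hD : (((k + 1) / 2 : ℕ) : ℝ) ≤ k := by
      exact_mod_cast (by omega : (k + 1) / 2 ≤ k)
    have hk' : (4 : ℝ) ≤ k := by exact_mod_cast hk
    calc (((k + 1) / 2 : ℕ) : ℝ) * (8 * k + 2) ≤ k * (10 * k) := by gcongr; linarith
      _ ≤ 10 * (k : ℝ) ^ 3 := by nlinarith [sq_nonneg (k : ℝ)]
  · rw [OrderedYao.natCeil_half]
    have h1 := OrderedYao.e_add_le (b := k / 4) (n := n) (by omega : 2 ≤ k) (by omega)
    have h2 : (k : ℝ) ≤ 8 * (k / 4 : ℕ) := by exact_mod_cast (by omega : k ≤ 8 * (k / 4))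
    nlinarith [Real.sqrt_nonneg (n : ℝ)]
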